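/- Let $I$ (students) and $S$ (schools) be finite sets. Each school $s$ has quotas $q_s^1,q_s^2\in\mathbb{Z}_{\ge 0}$ for periods 1 and 2 and a strict priority ordering $\pi_s$ of $I\cup\{\emptyset\}$, the same in both periods ($i$ is acceptable to $s$ if $i\,\pi_s\,\emptyset$). For $X\subseteq I$ let $Ch_s^t(X)$ be the set of the $q_s^t$ highest-priority acceptable students of $X$ (all of them if there are fewer). Each student $i$ has extended preferences: a strict linear order $\succ_i$ of the school-priority pairs $(S\cup\{\emptyset\})\times(S\cup\{\emptyset\})$, where the first component is the school in period 1 and the second the school at which priority for period 2 is held. The domain $\mathbf P$ of reasonably extended preferences consists of all $\succ_i$ for which there is a strict linear order $P_i$ of $S\cup\{\emptyset\}$ such that $\succ_i$ is - *priority-only*: $(\emptyset,\sigma)\succ_i(\emptyset,\tau)$ iff $\sigma P_i\tau$, for $\sigma,\tau\in S\cup\{\emptyset\}$, and $(\emptyset,\sigma)\succ_i(s,\sigma)$ for all $s\in S$, $\sigma\in S\cup\{\emptyset\}$; or - *willing to remain*: $(s,s)\succ_i(s,t)$ for all $s\ne t$ in $S$; $(s,s)\succ_i(t,t)$ whenever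 $s,t\in S$ and $s P_i t P_i\emptyset$; and $(\emptyset,\emptyset)\succ_i(\sigma,\tau)$ for all $\sigma\neq\tau$ in $S\cup\{\emptyset\}$. (Only preferences for which no pair $(\emptyset,s)$ or $(s,s)$ is better than $(\emptyset,\emptyset)$ can be of both types; they count as priority-only below.) The mechanism aSPDA maps a profile in $\mathbf P^I$ to a matching as follows. A priority-only student who applies to $s$ applies for the pair $(\emptyset,s)$, a willing-to-remain student for $(s,s)$; a student applies only for pairs better than $(\emptyset,\emptyset)$, in the order of $\succ_i$. Of a set $X$ of applicants, of whom $X_0$ are priority-only and $X_1$ willing to remain, school $s$ keeps $Ch_s^2\big(X_0\cup Ch_s^1(X_1)\big)$ and rejects the others. Step 1: run student-proposing deferred acceptance with the priority-only students alone. Step 2: in some order (which may depend arbitrarily on the reported profile) the willing-to-remain students enter one at a time; after each entry student-proposing deferred acceptance is continued from the current tentative matching, rejected or evicted students applying to their best remaining school, until no rejected student wants to apply to a further school. At the end each student receives the pair for which she is held, and $(\emptyset,\emptyset)$ if she is held by no school. Theorem. Whatever orders are used in Step 2, aSPDA is strategy-proof for students on $\mathbf P$: there are no profile $\succ\in\mathbf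 P^I$, student $i$ and report $\succ_i'\in\mathbf P$ such that the pair that $i$ obtains at $(\succ_i',\succ_{-i})$ is strictly better according to $\succ_i$ than the pair that she obtains at $\succ$. -/

import Mathlib

namespace Childcare

/-- A strict, transitive and complete preference relation on `X`;
`r.rel x y` means that `x` is strictly preferred to `y`. -/
structure StrictPref (X : Type*) where
  rel : X → X → Prop
  irrefl : ∀ x, ¬ rel x x
  trans : ∀ x y z, rel x y → rel y z → rel x z
  total : ∀ x y, x ≠ y → rel x y ∨ rel y x

/-- School-priority pairs `(S ∪ {∅}) × (S ∪ {∅})`: the first component is the school in period one,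
the second one the school at which priority for period two is held; `none` is `∅`. -/
abbrev SPair (S : Type*) := Option S × Option S

/-- `r` is priority-only, with underlying preference `P` over `S ∪ {∅}`: the ranking of priorities
(while staying at home in period one) is `P`, and in period one staying at home beats every school,
whatever the priority that comes with it. -/
def IsPriorityOnly {S : Type*} (P : StrictPref (Option S)) (r : StrictPref (SPair S)) : Prop :=
  (∀ σ τ : Option S, P.rel σ τ ↔ r.rel (none, σ) (none, τ)) ∧
  (∀ (s : S) (σ : Option S), r.rel (none, σ) (some s, σ))

/-- `r` satisfies willingness-to-remain, with underlying preference `P` over `S ∪ {∅}`. -/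
def IsWillingToRemain {S : Type*} (P : StrictPref (Option S)) (r : StrictPref (SPair S)) : Prop :=
  (∀ s t : S, s ≠ t → r.rel (some s, some s) (some s, some t)) ∧
  (∀ s t : S, P.rel (some s) (some t) → P.rel (some t) none →
    r.rel (some s, some s) (some t, some t)) ∧
  (∀ σ τ : Option S, σ ≠ τ → r.rel (none, none) (σ, τ))

/-- The domain of reasonably extended preferences. -/
def ReasonablyExtended (S : Type*) : Set (StrictPref (SPair S)) :=
  {r | ∃ P : StrictPref (Option S), IsPriorityOnly P r ∨ IsWillingToRemain P r}

/-- Profiles of reasonably extended preferences, one for every student. -/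
abbrev Profile (I S : Type*) := I → ReasonablyExtended S

/-- A matching, given on the students and on the schools (for periods one and two). -/
structure Matching (I S : Type*) where
  student : I → SPair S
  school : S → Finset I × Finset I
  mem_fst : ∀ i s, i ∈ (school s).1 ↔ (student i).1 = some s
  mem_snd : ∀ i s, i ∈ (school s).2 ↔ (student i).2 = some s

/-- A mechanism maps preference profiles to matchings. -/
abbrev Mechanism (I S : Type*) := Profile I S → Matching I S

open Classical in
/-- Strategy-proofness for students: at no profile can a student obtain a strictly better
school-priority pair, for her true preferences, by reporting other preferences of the domain. -/
def StrategyProofForStudents {I S : Type*} (φ : Mechanism I S) : Prop :=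
  ¬ ∃ (p : Profile I S) (i : I) (r' : ReasonablyExtended S),
    (p i).1.rel ((φ (Function.update p i r')).student i) ((φ p).student i)

/-- The report is priority-only.  (A report in the domain that is not priority-only satisfies
willingness-to-remain; the two types overlap only in reports for which none of the pairs `(∅, s)`
and `(s, s)` is better than `(∅, ∅)`.) -/
def PO {S : Type*} (r : StrictPref (SPair S)) : Prop :=
  ∃ P : StrictPref (Option S), IsPriorityOnly P r

open Classical in
/-- The pair that a student applies for when she applies to school `s`. -/
noncomputable def offer {S : Type*} (r : StrictPref (SPair S)) (s : S) : SPair S :=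
  if PO r then (none, some s) else (some s, some s)

/-- `s` is the top choice among the acceptable schools outside `R`. -/
def IsTop {S : Type*} (r : StrictPref (SPair S)) (R : Finset S) (s : S) : Prop :=
  s ∉ R ∧ r.rel (offer r s) (none, none) ∧
    ∀ t, t ∉ R → t ≠ s → r.rel (offer r s) (offer r t)

open Classical in
/-- The remaining top choice of a student who has been rejected by the schools in `R`
(`none` if no acceptable school is left). -/
noncomputable def target {S : Type*} (r : StrictPref (SPair S)) (R : Finset S) : Option S :=
  if h : ∃ s, IsTop r R s then some h.choose else none

open Classical in
/-- The choice of a school with priority ordering `π` (over the students and the empty seat `none`)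
and quota `n` from a set `X` of students: an acceptable student is chosen unless there are `n`
other students in `X` who all have higher priority. -/
noncomputable def Ch {I : Type*} (π : StrictPref (Option I)) (n : ℕ) (X : Finset I) : Finset I :=
  X.filter fun i => π.rel (some i) none ∧
    ¬ ∃ Y : Finset I, Y ⊆ X.erase i ∧ Y.card = n ∧ ∀ j ∈ Y, π.rel (some j) (some i)

open Classical in
/-- The students that a school with quotas `n` keeps among its applicants `X`. Willing-to-remain
applicants need a seat in both periods, priority-only applicants one in period two: the seats of
period one are filled with willing-to-remain applicants; those who get none give up the seat of
period two as well; the seats of period two are filled with the others. -/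
noncomputable def keep {I S : Type*} (p : Profile I S) (π : StrictPref (Option I)) (n : ℕ × ℕ)
    (X : Finset I) : Finset I :=
  Ch π n.2 (X.filter (fun i => PO (p i).1) ∪ Ch π n.1 (X.filter fun i => ¬ PO (p i).1))

section Algorithm

variable {I S : Type*} [Fintype I] [Fintype S]

open Classical in
/-- The students in the market `A` whose remaining top choice is `s`, where `R i` is the set of
schools that have already rejected `i`: the students held by `s` and the new applicants. -/
noncomputable def applicants (p : Profile I S) (A : Finset I) (R : I → Finset S) (s : S) :
    Finset I :=
  A.filter fun i => target (p i).1 (R i) = some s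

open Classical in
/-- One round of student-proposing deferred acceptance in the market `A`: every school rejects
the applicants that it does not keep. -/
noncomputable def round (p : Profile I S) (π : S → StrictPref (Option I)) (q : S → ℕ × ℕ)
    (A : Finset I) (R : I → Finset S) : I → Finset S :=
  fun i => R i ∪ Finset.univ.filter fun s =>
    i ∈ applicants p A R s ∧ i ∉ keep p (π s) (q s) (applicants p A R s)

open Classical in
/-- Student-proposing deferred acceptance in the market `A`, continued from the rejections `R`
until nobody is rejected any more. -/
noncomputable def spda (p : Profile I S) (π : S → StrictPref (Option I)) (q : S → ℕ × ℕ)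
    (A : Finset I) (R : I → Finset S) : I → Finset S :=
  if round p π q A R = R then R else spda p π q A (round p π q A R)
termination_by ∑ i, (R i)ᶜ.card
decreasing_by
  rename_i h
  have hle : ∀ i, R i ⊆ round p π q A R i := fun i => Finset.subset_union_left
  obtain ⟨i, hi⟩ := Function.ne_iff.mp h
  refine Finset.sum_lt_sum (fun j _ => Finset.card_le_card
    (Finset.compl_subset_compl.mpr (hle j))) ⟨i, Finset.mem_univ i, Finset.card_lt_card ?_⟩
  exact Finset.compl_ssubset_compl.mpr ((hle i).ssubset_of_ne (Ne.symm hi))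

/-- The order in which the willing-to-remain students enter; at every profile it may be any
order. -/
structure EntryOrder (I S : Type*) where
  order : Profile I S → List I
  nodup : ∀ p, (order p).Nodup
  mem_iff : ∀ p i, i ∈ order p ↔ ¬ PO (p i).1

open Classical in
/-- The rejections at the end of the adapted algorithm: first deferred acceptance among the
priority-only students; then the other students enter one by one, and after every entry deferred
acceptance goes on until nobody is rejected any more. -/
noncomputable def finalRejections (π : S → StrictPref (Option I)) (q : S → ℕ × ℕ)
    (ρ : EntryOrder I S) (p : Profile I S) : I → Finset S :=
  let A₁ : Finset I := Finset.univ.filter fun i => PO (p i).1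
  ((ρ.order p).foldl (fun (AR : Finset I × (I → Finset S)) i =>
      (insert i AR.1, spda p π q (insert i AR.1) AR.2))
    (A₁, spda p π q A₁ fun _ => ∅)).2

open Classical in
/-- The adapted student-proposing deferred acceptance mechanism: every student gets the pair that
she applied for at her remaining top choice, and `(∅, ∅)` if no acceptable school is left. -/
noncomputable def aSPDA (π : S → StrictPref (Option I)) (q : S → ℕ × ℕ) (ρ : EntryOrder I S) :
    Mechanism I S := fun p =>
  let μ : I → SPair S := fun i =>
    ((target (p i).1 (finalRejections π q ρ p i)).map (offer (p i).1)).getD (none, none)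
  { student := μ
    school := fun s => (Finset.univ.filter fun i => (μ i).1 = some s,
      Finset.univ.filter fun i => (μ i).2 = some s)
    mem_fst := by intro i s; simp
    mem_snd := by intro i s; simp }

end Algorithm

end Childcare

namespace Childcare

/-! ### Strict preferences -/

namespace StrictPref

variable {X Y : Type*}

/-! Each type of student applies for one pair per school, so aSPDA is deferred acceptance in an
ordinary many-to-one market (`market`). The two-stage choice of a school is substitutable and
satisfies the law of aggregate demand, so the outcome is the student-optimal stable assignment for
every entry order (`studentOptimal_finalRejections`).

A report may also change the type of the student, and with it the choice functions. A
willing-to-remain student posing as priority-only can only get pairs (∅,s), all worse than (∅,∅). A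
priority-only student posing as willing to remain gets some (s,s), but likes (∅,s) even more; it
suffices that her truthful outcome is at least as good as (∅,s). Asking for an extra seat in period
one does not alter choices that reject her anyway (`Ch_contenders_eq_of_notMem`), and this is all
that the truncation argument, based on the rural hospitals theorem, needs
(`StudentOptimal.weakPref_of_misreport`). -/

theorem asymm (r : StrictPref X) {x y : X} (h : r.rel x y) : ¬ r.rel y x :=
  fun h' => r.irrefl x (r.trans x y x h h')

/-- The preference over `Y` induced by an injective map into the alternatives. -/
def comap (r : StrictPref X) (f : Y → X) (hf : Function.Injective f) : StrictPref Y where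
  rel a b := r.rel (f a) (f b)
  irrefl a := r.irrefl (f a)
  trans a b c := r.trans (f a) (f b) (f c)
  total a b h := r.total (f a) (f b) (fun h' => h (hf h'))

theorem exists_best (r : StrictPref X) (Z : Finset X) (hZ : Z.Nonempty) :
    ∃ x ∈ Z, ∀ y ∈ Z, y ≠ x → r.rel x y := by
  classical
  induction hZ using Finset.Nonempty.cons_induction with
  | singleton a => exact ⟨a, by simp, by simp⟩
  | cons a s ha hs ih =>
    obtain ⟨x, hx, hbest⟩ := ih
    have hax : a ≠ x := fun h => ha (h ▸ hx)
    rcases r.total a x hax with h | h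
    · refine ⟨a, by simp, fun y hy hya => ?_⟩
      rcases Finset.mem_cons.1 hy with rfl | hy
      · exact absurd rfl hya
      · by_cases hyx : y = x
        · exact hyx ▸ h
        · exact r.trans _ _ _ h (hbest y hy hyx)
    · refine ⟨x, by simp [hx], fun y hy hyx => ?_⟩
      rcases Finset.mem_cons.1 hy with rfl | hy
      · exact h
      · exact hbest y hy hyx

end StrictPref

/-! ### Responsive choices and their two-stage composition -/

section Choice

variable {I : Type*}

open Classical in
-- Turns the definition by blocking sets into a count of better-ranked students, which is monotone
-- in `X`.
theorem mem_Ch {π : StrictPref (Option I)} {n : ℕ} {X : Finset I} {i : I} :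
    i ∈ Ch π n X ↔ i ∈ X ∧ π.rel (some i) none ∧
      (X.filter fun j => π.rel (some j) (some i)).card < n := by
  unfold Ch
  rw [Finset.mem_filter]
  refine and_congr_right fun _ => and_congr_right fun _ => ?_
  rw [← not_le, not_iff_not]
  constructor
  · rintro ⟨Y, hY, rfl, hab⟩
    exact Finset.card_le_card fun j hj =>
      Finset.mem_filter.2 ⟨Finset.mem_of_mem_erase (hY hj), hab j hj⟩
  · intro h
    obtain ⟨Y, hY, hc⟩ := Finset.exists_subset_card_eq h
    refine ⟨Y, fun j hj => ?_, hc, fun j hj => (Finset.mem_filter.1 (hY hj)).2⟩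
    have := Finset.mem_filter.1 (hY hj)
    refine Finset.mem_erase.2 ⟨?_, this.1⟩
    rintro rfl
    exact π.irrefl _ this.2

theorem Ch_subset (π : StrictPref (Option I)) (n : ℕ) (X : Finset I) : Ch π n X ⊆ X :=
  fun _ h => (mem_Ch.1 h).1

theorem Ch_substitutable {π : StrictPref (Option I)} {n : ℕ} {X Y : Finset I} (h : X ⊆ Y)
    {i : I} (hX : i ∈ X) (hY : i ∈ Ch π n Y) : i ∈ Ch π n X := by
  classical
  rw [mem_Ch] at hY ⊢
  exact ⟨hX, hY.2.1, (Finset.card_le_card (Finset.filter_subset_filter _ h)).trans_lt hY.2.2⟩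

open Classical in
/-- A responsive choice fills the quota as far as acceptable students permit. -/
theorem card_Ch (π : StrictPref (Option I)) (n : ℕ) (X : Finset I) :
    (Ch π n X).card = min n (X.filter fun i => π.rel (some i) none).card := by
  set Z := X.filter fun i => π.rel (some i) none with hZ
  let k : I → ℕ := fun i => (X.filter fun j => π.rel (some j) (some i)).card
  have hlt : ∀ i ∈ X, ∀ j ∈ X, π.rel (some i) (some j) → k i < k j := by
    intro i hi j _ hij
    refine Finset.card_lt_card (Finset.ssubset_iff_subset_ne.2 ⟨fun l hl => ?_, fun h => ?_⟩)
    · have := Finset.mem_filter.1 hl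
      exact Finset.mem_filter.2 ⟨this.1, π.trans _ _ _ this.2 hij⟩
    · have : i ∈ X.filter fun l => π.rel (some l) (some j) := Finset.mem_filter.2 ⟨hi, hij⟩
      rw [← h] at this
      exact π.irrefl _ (Finset.mem_filter.1 this).2
  have hinj : Set.InjOn k X := by
    intro i hi j hj hij
    by_contra hne
    rcases π.total (some i) (some j) (by simpa using hne) with h | h
    · exact (hlt i hi j hj h).ne hij
    · exact (hlt j hj i hi h).ne hij.symm
  have hZX : Z ⊆ X := Finset.filter_subset _ _
  -- Everyone ranked above an acceptable student is acceptable, so the ranks of `Z` lie below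
  -- `Z.card`; by injectivity they exhaust that range.
  have himg : Z.image k = Finset.range Z.card := by
    refine Finset.eq_of_subset_of_card_le (fun m hm => ?_) ?_
    · obtain ⟨i, hi, rfl⟩ := Finset.mem_image.1 hm
      refine Finset.mem_range.2 (Finset.card_lt_card
        (Finset.ssubset_iff_subset_ne.2 ⟨fun l hl => ?_, fun h => ?_⟩))
      · have := Finset.mem_filter.1 hl
        exact Finset.mem_filter.2 ⟨this.1, π.trans _ _ _ this.2 (Finset.mem_filter.1 hi).2⟩
      · rw [← h] at hi
        exact π.irrefl _ (Finset.mem_filter.1 hi).2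
    · rw [Finset.card_range, Finset.card_image_of_injOn (hinj.mono hZX)]
  have hCh : (Ch π n X).image k = Finset.range (min n Z.card) := by
    ext m
    simp only [Finset.mem_image, Finset.mem_range, lt_min_iff]
    constructor
    · rintro ⟨i, hi, rfl⟩
      have h := mem_Ch.1 hi
      refine ⟨h.2.2, Finset.mem_range.1 (himg ▸ Finset.mem_image_of_mem k ?_)⟩
      exact Finset.mem_filter.2 ⟨h.1, h.2.1⟩
    · rintro ⟨hm, hmZ⟩
      rw [← Finset.mem_range, ← himg] at hmZ
      obtain ⟨i, hi, rfl⟩ := Finset.mem_image.1 hmZ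
      have h := Finset.mem_filter.1 hi
      exact ⟨i, mem_Ch.2 ⟨h.1, h.2, hm⟩, rfl⟩
  rw [← Finset.card_range (min n Z.card), ← hCh,
    Finset.card_image_of_injOn (hinj.mono (Ch_subset π n X))]

/-- Rejected students are irrelevant, for a substitutable choice satisfying the law of aggregate
demand. -/
theorem choice_eq_of_subset {c : Finset I → Finset I}
    (hsub : ∀ X Y i, X ⊆ Y → i ∈ X → i ∈ c Y → i ∈ c X)
    (hcard : ∀ X Y, X ⊆ Y → (c X).card ≤ (c Y).card)
    {X Y : Finset I} (h : X ⊆ Y) (hc : c Y ⊆ X) : c X = c Y :=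
  (Finset.eq_of_subset_of_card_le (fun i hi => hsub X Y i h (hc hi) hi) (hcard X Y h)).symm

theorem card_Ch_mono (π : StrictPref (Option I)) (n : ℕ) {X Y : Finset I} (h : X ⊆ Y) :
    (Ch π n X).card ≤ (Ch π n Y).card := by
  classical
  rw [card_Ch, card_Ch]
  exact min_le_min_left _ (Finset.card_le_card (Finset.filter_subset_filter _ h))

theorem Ch_eq_of_subset {π : StrictPref (Option I)} {n : ℕ} {X Y : Finset I} (h : X ⊆ Y)
    (hc : Ch π n Y ⊆ X) : Ch π n X = Ch π n Y :=
  choice_eq_of_subset (fun _ _ _ h h' => Ch_substitutable h h')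
    (fun _ _ h => card_Ch_mono π n h) h hc

open Classical in
-- Whether `j` is chosen depends only on those above `j`, so restricting to the students above `i`
-- commutes with choosing; all of them are acceptable because `i` is.
theorem card_filter_above_Ch (π : StrictPref (Option I)) (n : ℕ) (X : Finset I) {i : I}
    (hi : π.rel (some i) none) :
    ((Ch π n X).filter fun j => π.rel (some j) (some i)).card =
      min n (X.filter fun j => π.rel (some j) (some i)).card := by
  have h : (Ch π n X).filter (fun j => π.rel (some j) (some i)) =
      Ch π n (X.filter fun j => π.rel (some j) (some i)) := by
    ext j
    simp only [Finset.mem_filter, mem_Ch, Finset.filter_filter]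
    have : π.rel (some j) (some i) →
        X.filter (fun l => π.rel (some l) (some i) ∧ π.rel (some l) (some j)) =
          X.filter fun l => π.rel (some l) (some j) := fun hj =>
      Finset.filter_congr fun l _ => ⟨fun h => h.2, fun h => ⟨π.trans _ _ _ h hj, h⟩⟩
    constructor
    · rintro ⟨⟨h1, h2, h3⟩, h4⟩
      exact ⟨⟨h1, h4⟩, h2, by rwa [this h4]⟩
    · rintro ⟨⟨h1, h4⟩, h2, h3⟩
      exact ⟨⟨h1, h2, by rwa [this h4] at h3⟩, h4⟩
  rw [h, card_Ch, Finset.filter_filter]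
  congr 2
  exact Finset.filter_congr fun l _ => ⟨fun h => h.1, fun h => ⟨h, π.trans _ _ _ h hi⟩⟩

open Classical in
/-- The students that can compete for the seats of period two, if those in `T` are
priority-only. -/
noncomputable def contenders (T : I → Prop) (π : StrictPref (Option I)) (n : ℕ)
    (X : Finset I) : Finset I :=
  X.filter T ∪ Ch π n (X.filter fun i => ¬ T i)

open Classical in
theorem disjoint_contenders (T : I → Prop) (π : StrictPref (Option I)) (n : ℕ)
    (X : Finset I) : Disjoint (X.filter T) (Ch π n (X.filter fun i => ¬ T i)) :=
  (Finset.disjoint_filter_filter_not X X T).mono_right (Ch_subset _ _ _)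

theorem mem_contenders {T : I → Prop} {π : StrictPref (Option I)} {n : ℕ} {X : Finset I}
    {i : I} : i ∈ contenders T π n X ↔
      (i ∈ X ∧ T i) ∨ i ∈ Ch π n (by classical exact X.filter fun i => ¬ T i) := by
  classical
  unfold contenders
  rw [Finset.mem_union, Finset.mem_filter]

theorem contenders_subset (T : I → Prop) (π : StrictPref (Option I)) (n : ℕ)
    (X : Finset I) : contenders T π n X ⊆ X := by
  classical
  exact Finset.union_subset (Finset.filter_subset _ _)
    ((Ch_subset _ _ _).trans (Finset.filter_subset _ _))

/-- With a larger pool some contenders drop out, but the number ranked above `i` is `a + min m b`,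
where `a` and `b` count the two types of applicants above `i`. This is monotone in the pool. -/
theorem Ch_contenders_substitutable (T : I → Prop) (π : StrictPref (Option I)) (m n : ℕ)
    {X Y : Finset I} {i : I} (h : X ⊆ Y) (hX : i ∈ X)
    (hY : i ∈ Ch π n (contenders T π m Y)) : i ∈ Ch π n (contenders T π m X) := by
  classical
  obtain ⟨hc, hi, hn⟩ := mem_Ch.1 hY
  have hmem : i ∈ contenders T π m X := by
    rcases mem_contenders.1 hc with hT | hT
    · exact mem_contenders.2 (Or.inl ⟨hX, hT.2⟩)
    · exact mem_contenders.2 (Or.inr (Ch_substitutable (Finset.filter_subset_filter _ h)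
        (Finset.mem_filter.2 ⟨hX, (Finset.mem_filter.1 (Ch_subset _ _ _ hT)).2⟩) hT))
  have hcard : ∀ Z : Finset I,
      ((contenders T π m Z).filter fun j => π.rel (some j) (some i)).card =
        ((Z.filter T).filter fun j => π.rel (some j) (some i)).card +
          min m ((Z.filter fun j => ¬ T j).filter fun j => π.rel (some j) (some i)).card := by
    intro Z
    rw [contenders, Finset.filter_union, Finset.card_union_of_disjoint
      (Finset.disjoint_filter_filter (disjoint_contenders T π m Z)),
      card_filter_above_Ch π m _ hi]
  refine mem_Ch.2 ⟨hmem, hi, lt_of_le_of_lt ?_ hn⟩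
  rw [hcard, hcard]
  have hmono := fun (Q : I → Prop) [DecidablePred Q] => Finset.card_le_card (Finset.filter_subset_filter
    (fun j => π.rel (some j) (some i)) (Finset.filter_subset_filter Q h))
  exact add_le_add (hmono T) (min_le_min_left _ (hmono fun j => ¬ T j))

theorem card_Ch_contenders_mono (T : I → Prop) (π : StrictPref (Option I)) (m n : ℕ)
    {X Y : Finset I} (h : X ⊆ Y) :
    (Ch π n (contenders T π m X)).card ≤ (Ch π n (contenders T π m Y)).card := by
  classical
  have hcard : ∀ Z : Finset I,
      ((contenders T π m Z).filter fun j => π.rel (some j) none).card =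
        ((Z.filter T).filter fun j => π.rel (some j) none).card +
          (Ch π m (Z.filter fun j => ¬ T j)).card := by
    intro Z
    rw [contenders, Finset.filter_union, Finset.card_union_of_disjoint
      (Finset.disjoint_filter_filter (disjoint_contenders T π m Z))]
    congr 2
    exact Finset.filter_true_of_mem fun j hj => (mem_Ch.1 hj).2.1
  rw [card_Ch, card_Ch, hcard, hcard]
  exact min_le_min_left _ (add_le_add
    (Finset.card_le_card (Finset.filter_subset_filter _ (Finset.filter_subset_filter _ h)))
    (card_Ch_mono π m (Finset.filter_subset_filter _ h)))

/-- If a priority-only student is rejected, then nothing changes if she asks for a seat in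
period one, too. -/
theorem Ch_contenders_eq_of_notMem {T T' : I → Prop} {π : StrictPref (Option I)} {m n : ℕ}
    {X : Finset I} {i : I} (hT : T i) (hT' : ¬ T' i) (hne : ∀ j, j ≠ i → (T' j ↔ T j))
    (hi : i ∉ Ch π n (contenders T π m X)) :
    Ch π n (contenders T' π m X) = Ch π n (contenders T π m X) := by
  classical
  by_cases hiX : i ∈ X
  · have hiZ : i ∈ contenders T π m X := mem_contenders.2 (Or.inl ⟨hiX, hT⟩)
    have hins : X.filter (fun j => ¬ T' j) = insert i (X.filter fun j => ¬ T j) := by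
      ext j
      by_cases hji : j = i
      · subst hji; simp [hiX, hT']
      · simp [hji, hne j hji]
    -- Moving `i` to the other type can only shrink the set of contenders; irrelevance of rejected
    -- students applies once everyone kept is still a contender.
    refine Ch_eq_of_subset (fun j hj => ?_) (fun j hj => ?_)
    · by_cases hji : j = i
      · exact hji ▸ hiZ
      · rcases mem_contenders.1 hj with ⟨hjX, hj'⟩ | hj'
        · exact mem_contenders.2 (Or.inl ⟨hjX, (hne j hji).1 hj'⟩)
        · refine mem_contenders.2 (Or.inr (Ch_substitutable (Y := X.filter fun j => ¬ T' j)
            (hins ▸ Finset.subset_insert _ _) ?_ hj'))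
          have := Finset.mem_filter.1 (Ch_subset _ _ _ hj')
          exact Finset.mem_filter.2 ⟨this.1, fun h => this.2 ((hne j hji).2 h)⟩
    · have hji : j ≠ i := fun h => hi (h ▸ hj)
      obtain ⟨hjZ, hja, hjn⟩ := mem_Ch.1 hj
      -- If `i` outranked a kept student, `i` would be kept too. Hence `i` cannot displace `j` in
      -- period one.
      have habove : ¬ π.rel (some i) (some j) := by
        intro hij
        refine hi (mem_Ch.2 ⟨hiZ, π.trans _ _ _ hij hja, lt_of_le_of_lt
          (Finset.card_le_card fun l hl => ?_) hjn⟩)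
        have := Finset.mem_filter.1 hl
        exact Finset.mem_filter.2 ⟨this.1, π.trans _ _ _ this.2 hij⟩
      rcases mem_contenders.1 hjZ with ⟨hjX, hj'⟩ | hj'
      · exact mem_contenders.2 (Or.inl ⟨hjX, (hne j hji).2 hj'⟩)
      · refine mem_contenders.2 (Or.inr ?_)
        obtain ⟨h1, h2, h3⟩ := mem_Ch.1 hj'
        refine mem_Ch.2 ⟨?_, h2, ?_⟩
        · rw [hins]; exact Finset.mem_insert_of_mem h1
        · rw [hins, Finset.filter_insert, if_neg habove]; exact h3
  · have h0 : ∀ j ∈ X, (T' j ↔ T j) := fun j hj => hne j fun h => hiX (h ▸ hj)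
    unfold contenders
    rw [Finset.filter_congr h0, Finset.filter_congr fun j hj => not_congr (h0 j hj)]

end Choice

/-! ### Stable assignments and the rural hospitals theorem -/

/-- A market in which every school has a substitutable choice function that satisfies the law of
aggregate demand. -/
structure Market (I S : Type*) where
  pref : I → StrictPref S
  acc : I → Set S
  ch : S → Finset I → Finset I
  ch_subset : ∀ s X, ch s X ⊆ X
  substitutable : ∀ s X Y i, X ⊆ Y → i ∈ X → i ∈ ch s Y → i ∈ ch s X
  card_mono : ∀ s X Y, X ⊆ Y → (ch s X).card ≤ (ch s Y).card

namespace Market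

variable {I S : Type*}

theorem ch_eq_of_subset (M : Market I S) {s : S} {X Y : Finset I} (h : X ⊆ Y)
    (hc : M.ch s Y ⊆ X) : M.ch s X = M.ch s Y :=
  choice_eq_of_subset (M.substitutable s) (M.card_mono s) h hc

/-- `s` is the best acceptable school outside `R` for student `j`. -/
def Top (M : Market I S) (j : I) (R : Finset S) (s : S) : Prop :=
  s ∉ R ∧ s ∈ M.acc j ∧ ∀ t, t ∉ R → t ∈ M.acc j → t ≠ s → (M.pref j).rel s t

theorem Top.unique {M : Market I S} {j : I} {R : Finset S} {s t : S} (hs : M.Top j R s)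
    (ht : M.Top j R t) : s = t := by
  by_contra h
  exact (M.pref j).asymm (hs.2.2 t ht.1 ht.2.1 (Ne.symm h)) (ht.2.2 s hs.1 hs.2.1 h)

theorem exists_top [Fintype S] (M : Market I S) {j : I} {R : Finset S} {s : S} (hs : s ∉ R)
    (hacc : s ∈ M.acc j) : ∃ t, M.Top j R t := by
  classical
  obtain ⟨t, ht, hbest⟩ := (M.pref j).exists_best
    (Finset.univ.filter fun t => t ∉ R ∧ t ∈ M.acc j) ⟨s, by simp [hs, hacc]⟩
  have ht := (Finset.mem_filter.1 ht).2
  exact ⟨t, ht.1, ht.2, fun u hu hua hut => hbest u (by simp [hu, hua]) hut⟩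

/-- `s` is at least as good as `t`. -/
def WeakPref (M : Market I S) (j : I) (s t : S) : Prop :=
  s = t ∨ (M.pref j).rel s t

theorem WeakPref.trans {M : Market I S} {j : I} {s t u : S} (h : M.WeakPref j s t)
    (h' : M.WeakPref j t u) : M.WeakPref j s u := by
  rcases h with rfl | h
  · exact h'
  · rcases h' with rfl | h'
    · exact Or.inr h
    · exact Or.inr ((M.pref j).trans _ _ _ h h')

variable [Fintype I]

open Classical in
/-- The students who weakly prefer `s` to what they get under `μ`. -/
noncomputable def demand (M : Market I S) (μ : I → Option S) (s : S) : Finset I :=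
  Finset.univ.filter fun j => s ∈ M.acc j ∧ ∀ t, μ j = some t → M.WeakPref j s t

open Classical in
/-- The students assigned to `s`. -/
noncomputable def assigned (μ : I → Option S) (s : S) : Finset I :=
  Finset.univ.filter fun j => μ j = some s

theorem mem_demand {M : Market I S} {μ : I → Option S} {s : S} {j : I} :
    j ∈ M.demand μ s ↔ s ∈ M.acc j ∧ ∀ t, μ j = some t → M.WeakPref j s t := by
  simp [demand]

theorem mem_assigned {μ : I → Option S} {s : S} {j : I} :
    j ∈ assigned μ s ↔ μ j = some s := by
  simp [assigned]

/-- Every school chooses its assigned students among all those who would like to attend it. -/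
def Stable (M : Market I S) (μ : I → Option S) : Prop :=
  ∀ s, M.ch s (M.demand μ s) = assigned μ s

/-- A stable assignment that every student weakly prefers to every stable assignment. -/
def StudentOptimal (M : Market I S) (μ : I → Option S) : Prop :=
  M.Stable μ ∧ ∀ ν, M.Stable ν → ∀ j s, ν j = some s → ∃ t, μ j = some t ∧ M.WeakPref j t s

theorem Stable.acc {M : Market I S} {μ : I → Option S} (h : M.Stable μ) {j : I} {s : S}
    (hj : μ j = some s) : s ∈ M.acc j := by
  have : j ∈ M.ch s (M.demand μ s) := by rw [h s]; exact mem_assigned.2 hj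
  exact (mem_demand.1 (M.ch_subset _ _ this)).1

/-- Transfers stability between markets: the smaller demand still contains the assigned students, so
only rejected ones are removed. -/
theorem Stable.of_demand_subset {M M' : Market I S} {μ : I → Option S} (h : M.Stable μ)
    (hch : ∀ s, M'.ch s (M'.demand μ s) = M.ch s (M'.demand μ s))
    (hsub : ∀ s, M'.demand μ s ⊆ M.demand μ s) (hacc : ∀ j s, μ j = some s → s ∈ M'.acc j) :
    M'.Stable μ := by
  intro s
  rw [hch, ← h s]
  refine M.ch_eq_of_subset (hsub s) ?_
  rw [h s]
  intro j hj
  rw [mem_assigned] at hj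
  exact mem_demand.2 ⟨hacc j s hj, fun t ht => Or.inl (Option.some_injective _ (hj ▸ ht))⟩

theorem card_isSome [Fintype S] (μ : I → Option S) :
    (Finset.univ.filter fun j => (μ j).isSome).card = ∑ s, (assigned μ s).card := by
  classical
  rw [← Finset.card_biUnion]
  · congr 1
    ext j
    simp [mem_assigned, Option.isSome_iff_exists]
  · intro s _ t _ hst
    refine Finset.disjoint_left.2 fun j hj hj' => hst ?_
    rw [mem_assigned] at hj hj'
    exact Option.some_injective _ (hj.symm.trans hj')

/-- The rural hospitals theorem. -/
theorem StudentOptimal.isSome_iff [Fintype S] {M : Market I S} {μ ν : I → Option S}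
    (hμ : M.StudentOptimal μ) (hν : M.Stable ν) (j : I) : (ν j).isSome ↔ (μ j).isSome := by
  have hsub : (Finset.univ.filter fun j => (ν j).isSome) ⊆
      Finset.univ.filter fun j => (μ j).isSome := by
    intro j hj
    obtain ⟨s, hs⟩ := Option.isSome_iff_exists.1 (Finset.mem_filter.1 hj).2
    obtain ⟨t, ht, -⟩ := hμ.2 ν hν j s hs
    simp [ht]
  have hcard : (Finset.univ.filter fun j => (μ j).isSome).card ≤
      (Finset.univ.filter fun j => (ν j).isSome).card := by
    rw [card_isSome, card_isSome]
    refine Finset.sum_le_sum fun s _ => ?_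
    rw [← hμ.1 s, ← hν s]
    -- Students are better off under `μ`, so every school is demanded by fewer of them there.
    refine M.card_mono s _ _ fun j hj => ?_
    rw [mem_demand] at hj ⊢
    refine ⟨hj.1, fun t ht => ?_⟩
    obtain ⟨u, hu, hut⟩ := hμ.2 ν hν j t ht
    exact (hj.2 u hu).trans hut
  have := congrArg (j ∈ ·) (Finset.eq_of_subset_of_card_le hsub hcard)
  simpa using this

/-! ### Deferred acceptance and optimality for students -/

open Classical in
/-- The students in `A` whose best school outside their rejections `R` is `s`. -/
noncomputable def applicants (M : Market I S) (A : Finset I) (R : I → Finset S) (s : S) :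
    Finset I :=
  Finset.univ.filter fun j => j ∈ A ∧ M.Top j (R j) s

open Classical in
/-- The students in `A` who have applied to `s` so far. -/
noncomputable def proposers (M : Market I S) (A : Finset I) (R : I → Finset S) (s : S) :
    Finset I :=
  Finset.univ.filter fun j => j ∈ A ∧ (s ∈ R j ∨ M.Top j (R j) s)

theorem mem_applicants {M : Market I S} {A : Finset I} {R : I → Finset S} {s : S} {j : I} :
    j ∈ M.applicants A R s ↔ j ∈ A ∧ M.Top j (R j) s := by
  simp [applicants]

theorem mem_proposers {M : Market I S} {A : Finset I} {R : I → Finset S} {s : S} {j : I} :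
    j ∈ M.proposers A R s ↔ j ∈ A ∧ (s ∈ R j ∨ M.Top j (R j) s) := by
  simp [proposers]

theorem applicants_subset_proposers (M : Market I S) (A : Finset I) (R : I → Finset S) (s : S) :
    M.applicants A R s ⊆ M.proposers A R s := fun _ hj =>
  mem_proposers.2 ⟨(mem_applicants.1 hj).1, Or.inr (mem_applicants.1 hj).2⟩

/-- The rejections `R` can arise in deferred acceptance in the market `A`. -/
structure Justified (M : Market I S) (A : Finset I) (R : I → Finset S) : Prop where
  empty : ∀ j, j ∉ A → R j = ∅
  acc : ∀ j s, s ∈ R j → s ∈ M.acc j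
  better : ∀ j s t, s ∈ R j → t ∉ R j → t ∈ M.acc j → (M.pref j).rel s t
  rejected : ∀ j s, s ∈ R j → j ∉ M.ch s (M.proposers A R s)
  unachievable : ∀ μ, M.Stable μ → ∀ j s, μ j = some s → s ∉ R j

theorem justified_empty (M : Market I S) (A : Finset I) : M.Justified A fun _ => ∅ where
  empty _ _ := rfl
  acc _ _ h := absurd h (Finset.notMem_empty _)
  better _ _ _ h _ := absurd h (Finset.notMem_empty _)
  rejected _ _ h := absurd h (Finset.notMem_empty _)
  unachievable _ _ _ _ _ := Finset.notMem_empty _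

/-- Any part of the pending rejections may be carried out, which covers parallel rounds as well as
single rejections. Substitutability makes earlier rejections persist as proposers accumulate. -/
theorem Justified.step {M : Market I S} {A : Finset I} {R R' : I → Finset S}
    (h : M.Justified A R) (hle : ∀ j, R j ⊆ R' j)
    (hnew : ∀ j s, s ∈ R' j → s ∈ R j ∨
      (j ∈ M.applicants A R s ∧ j ∉ M.ch s (M.applicants A R s))) :
    M.Justified A R' := by
  have hprop : ∀ s, M.proposers A R s ⊆ M.proposers A R' s := by
    intro s j hj
    obtain ⟨hA, hj⟩ := mem_proposers.1 hj
    refine mem_proposers.2 ⟨hA, ?_⟩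
    by_cases hs : s ∈ R' j
    · exact Or.inl hs
    · rcases hj with hj | hj
      · exact absurd (hle j hj) hs
      · exact Or.inr ⟨hs, hj.2.1, fun t ht => hj.2.2 t fun h' => ht (hle j h')⟩
  refine ⟨fun j hj => ?_, fun j s hs => ?_, fun j s t hs ht hta => ?_, fun j s hs => ?_,
    fun μ hμ j s hj hs => ?_⟩
  · refine Finset.eq_empty_of_forall_notMem fun s hs => ?_
    rcases hnew j s hs with h' | h'
    · simp [h.empty j hj] at h'
    · exact hj (mem_applicants.1 h'.1).1
  · rcases hnew j s hs with h' | h'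
    · exact h.acc j s h'
    · exact (mem_applicants.1 h'.1).2.2.1
  · have ht' : t ∉ R j := fun h' => ht (hle j h')
    rcases hnew j s hs with h' | h'
    · exact h.better j s t h' ht' hta
    · exact (mem_applicants.1 h'.1).2.2.2 t ht' hta fun hts => ht (hts ▸ hs)
  · intro hch
    rcases hnew j s hs with h' | ⟨h', h''⟩
    · have hA : j ∈ A := by
        by_contra hA
        simp [h.empty j hA] at h'
      exact h.rejected j s h' (M.substitutable s _ _ j (hprop s)
        (mem_proposers.2 ⟨hA, Or.inl h'⟩) hch)
    · exact h'' (M.substitutable s _ _ j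
        ((M.applicants_subset_proposers A R s).trans (hprop s)) h' hch)
  · rcases hnew j s hs with h' | ⟨h', h''⟩
    · exact h.unachievable μ hμ j s hj h'
    -- No applicant has been rejected by her school under `μ`, so all applicants to `s` demand `s`
    -- at `μ`; a school keeping `j` among them all would keep `j` now.
    · refine h'' (M.substitutable s _ (M.demand μ s) j (fun k hk => ?_) h' ?_)
      · have hk := (mem_applicants.1 hk).2
        refine mem_demand.2 ⟨hk.2.1, fun t ht => ?_⟩
        by_cases hts : t = s
        · exact Or.inl hts.symm
        · exact Or.inr (hk.2.2 t (h.unachievable μ hμ k t ht) (hμ.acc ht) hts)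
      · rw [hμ s]; exact mem_assigned.2 hj

/-- Entrants only add proposers, so by substitutability no past rejection is undone. This is why the
order of entry is immaterial. -/
theorem Justified.mono {M : Market I S} {A A' : Finset I} {R : I → Finset S}
    (h : M.Justified A R) (hA : A ⊆ A') : M.Justified A' R where
  empty j hj := h.empty j fun h' => hj (hA h')
  acc := h.acc
  better := h.better
  rejected j s hs hch := by
    have hjA : j ∈ A := by
      by_contra hA
      simp [h.empty j hA] at hs
    refine h.rejected j s hs (M.substitutable s _ _ j (fun k hk => ?_)
      (mem_proposers.2 ⟨hjA, Or.inl hs⟩) hch)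
    exact mem_proposers.2 ⟨hA (mem_proposers.1 hk).1, (mem_proposers.1 hk).2⟩
  unachievable := h.unachievable

variable [Fintype S]

/-- When nobody is rejected any more, the current assignment is optimal for students. -/
theorem Justified.studentOptimal {M : Market I S} {R : I → Finset S}
    (h : M.Justified Finset.univ R)
    (hfix : ∀ s, M.applicants Finset.univ R s ⊆ M.ch s (M.applicants Finset.univ R s))
    {μ : I → Option S} (hμ : ∀ j s, μ j = some s ↔ M.Top j (R j) s) : M.StudentOptimal μ := by
  refine ⟨fun s => ?_, fun ν hν j s hs => ?_⟩
  -- Students propose in order of preference, so those who demand `s` at the end are those who have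
  -- ever proposed to it.
  · have hd : M.demand μ s = M.proposers Finset.univ R s := by
      ext j
      rw [mem_demand, mem_proposers]
      constructor
      · rintro ⟨hs, hbest⟩
        refine ⟨Finset.mem_univ j, or_iff_not_imp_left.2 fun hsR => ?_⟩
        obtain ⟨t, ht⟩ := M.exists_top hsR hs
        rcases hbest t ((hμ j t).2 ht) with rfl | hst
        · exact ht
        · by_cases hst' : s = t
          · exact hst' ▸ ht
          · exact absurd (ht.2.2 s hsR hs hst') ((M.pref j).asymm hst)
      · rintro ⟨-, hs | hs⟩
        · refine ⟨h.acc j s hs, fun t ht => Or.inr ?_⟩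
          have ht := (hμ j t).1 ht
          exact h.better j s t hs ht.1 ht.2.1
        · exact ⟨hs.2.1, fun t ht => Or.inl (hs.unique ((hμ j t).1 ht))⟩
    have ha : assigned μ s = M.applicants Finset.univ R s := by
      ext j
      simp [mem_assigned, mem_applicants, hμ]
    rw [hd, ha]
    have hsub := M.applicants_subset_proposers Finset.univ R s
    have hc : M.ch s (M.proposers Finset.univ R s) ⊆ M.applicants Finset.univ R s := by
      intro j hj
      have hj' := mem_proposers.1 (M.ch_subset _ _ hj)
      exact mem_applicants.2 ⟨hj'.1, hj'.2.resolve_left fun hs => h.rejected j s hs hj⟩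
    rw [← M.ch_eq_of_subset hsub hc]
    exact (M.ch_subset _ _).antisymm (hfix s)
  · have hsR := h.unachievable ν hν j s hs
    obtain ⟨t, ht⟩ := M.exists_top hsR (hν.acc hs)
    refine ⟨t, (hμ j t).2 ht, ?_⟩
    by_cases hst : s = t
    · exact Or.inl hst.symm
    · exact Or.inr (ht.2.2 s hsR (hν.acc hs) hst)

/-- A maximal justified family of rejections has no pending rejection, since carrying one out would
enlarge it. -/
theorem exists_studentOptimal (M : Market I S) : ∃ μ, M.StudentOptimal μ := by
  classical
  obtain ⟨R, hR, hmax⟩ := (Set.toFinite {R | M.Justified Finset.univ R}).exists_maximal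
    ⟨_, M.justified_empty _⟩
  refine ⟨fun j => if h : ∃ s, M.Top j (R j) s then some h.choose else none,
    Market.Justified.studentOptimal hR (fun s i hi => ?_) fun j s => ?_⟩
  · by_contra hch
    have hle : R ≤ fun j => if j = i then insert s (R j) else R j := by
      intro j
      dsimp only
      split_ifs
      · exact Finset.subset_insert _ _
      · exact le_rfl
    have hJ : M.Justified Finset.univ fun j => if j = i then insert s (R j) else R j := by
      refine Market.Justified.step hR hle fun j t ht => ?_
      split_ifs at ht with hji
      · rcases Finset.mem_insert.1 ht with rfl | ht
        · exact Or.inr (hji ▸ ⟨hi, hch⟩)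
        · exact Or.inl ht
      · exact Or.inl ht
    have : s ∈ R i := hmax hJ hle i (by simp)
    exact (mem_applicants.1 hi).2.1 this
  · by_cases h : ∃ s, M.Top j (R j) s
    · rw [dif_pos h]
      refine ⟨fun hs => Option.some_injective _ hs ▸ h.choose_spec, fun hs => ?_⟩
      rw [h.choose_spec.unique hs]
    · rw [dif_neg h]
      exact ⟨fun hs => by simp at hs, fun hs => absurd ⟨s, hs⟩ h⟩

/-! ### Misreports in a market -/

/-- A student does not gain by misreporting her preferences over schools, even if the report also
makes schools treat her differently, as long as this does not matter when she is rejected. -/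
theorem StudentOptimal.weakPref_of_misreport {M M' : Market I S} {μ μ' : I → Option S} {i : I}
    (hμ : M.StudentOptimal μ) (hμ' : M'.Stable μ')
    (hpref : ∀ j, j ≠ i → M'.pref j = M.pref j) (hacc : ∀ j, j ≠ i → M'.acc j = M.acc j)
    (hch : ∀ s X, i ∉ M.ch s X → M'.ch s X = M.ch s X)
    {s : S} (hs : μ' i = some s) (hsa : s ∈ M.acc i) :
    ∃ t, μ i = some t ∧ M.WeakPref i t s := by
  classical
  -- In `N` student `i` keeps the misreport's choice functions but lists only `s`; in `L` she is
  -- truthful but truncates her list below `s`.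
  let N : Market I S := { M' with acc := Function.update M'.acc i {s} }
  let L : Market I S :=
    { M with acc := Function.update M.acc i {t | t ∈ M.acc i ∧ M.WeakPref i t s} }
  have hN : N.Stable μ' := by
    refine hμ'.of_demand_subset (fun _ => rfl) (fun t j hj => ?_) fun j t ht => ?_
    · rw [mem_demand] at hj ⊢
      refine ⟨?_, hj.2⟩
      by_cases hji : j = i
      · subst hji
        have : t = s := by simpa [N] using hj.1
        exact this ▸ hμ'.acc hs
      · simpa [N, hji] using hj.1
    · by_cases hji : j = i
      · subst hji
        have : t = s := Option.some_injective _ (ht.symm.trans hs)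
        simp [N, this]
      · simpa [N, hji] using hμ'.acc ht
  obtain ⟨ν, hν⟩ := L.exists_studentOptimal
  cases hνi : ν i with
  | some u =>
    have hu : u ∈ M.acc i ∧ M.WeakPref i u s := by simpa [L] using hν.1.acc hνi
    -- Undoing the truncation adds no demand: holding `u`, she demands only schools at least as good
    -- as `u`, which are on the truncated list.
    have hM : M.Stable ν := by
      refine hν.1.of_demand_subset (fun _ => rfl) (fun t j hj => ?_) fun j t ht => ?_
      · rw [mem_demand] at hj ⊢
        refine ⟨?_, hj.2⟩
        by_cases hji : j = i
        · subst hji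
          have : t ∈ M.acc j ∧ M.WeakPref j t s := ⟨hj.1, (hj.2 u hνi).trans hu.2⟩
          simpa [L] using this
        · simpa [L, hji] using hj.1
      · by_cases hji : j = i
        · subst hji
          have : t = u := Option.some_injective _ (ht.symm.trans hνi)
          exact this ▸ hu.1
        · simpa [L, hji] using hν.1.acc ht
    obtain ⟨t, ht, htu⟩ := hμ.2 ν hM i u hνi
    exact ⟨t, ht, htu.trans hu.2⟩
  | none =>
    exfalso
    have hsub : ∀ t, N.demand ν t ⊆ L.demand ν t := by
      intro t j hj
      rw [mem_demand] at hj ⊢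
      by_cases hji : j = i
      · subst hji
        have : t = s := by simpa [N] using hj.1
        subst this
        exact ⟨by simpa [L, WeakPref] using Or.inl hsa, fun u hu => by simp [hνi] at hu⟩
      · refine ⟨by simpa [N, L, hji, hacc j hji] using hj.1, fun u hu => ?_⟩
        have := hj.2 u hu
        simpa only [WeakPref, N, L, hpref j hji] using this
    have hacc' : ∀ j t, ν j = some t → t ∈ N.acc j := by
      intro j t ht
      by_cases hji : j = i
      · simp [hji, hνi] at ht
      · simpa [N, L, hji, hacc j hji] using hν.1.acc ht
    -- Unassigned in `ν`, `i` is rejected everywhere, so `hch` identifies the choices of the two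
    -- markets.
    have hNν : N.Stable ν := by
      refine hν.1.of_demand_subset (fun t => hch t _ fun hi => ?_) hsub hacc'
      have : i ∈ L.ch t (L.demand ν t) := by
        have hstab := hν.1 t
        have heq : L.ch t (N.demand ν t) = L.ch t (L.demand ν t) := by
          refine L.ch_eq_of_subset (hsub t) ?_
          rw [hstab]
          intro j hj
          rw [mem_assigned] at hj
          exact mem_demand.2 ⟨hacc' j t hj,
            fun u hu => Or.inl (Option.some_injective _ (hj ▸ hu))⟩
        rw [← heq]; exact hi
      rw [hν.1 t, mem_assigned, hνi] at this
      simp at this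
    -- Rural hospitals in `N`: `i` is assigned under `μ'` but not under `ν`, both stable.
    obtain ⟨ξ, hξ⟩ := N.exists_studentOptimal
    have := (hξ.isSome_iff hNν i).trans (hξ.isSome_iff hN i).symm
    simp [hνi, hs] at this

end Market

/-! ### The adapted mechanism as deferred acceptance in a market -/

section Mechanism

variable {I S : Type*}

theorem offer_injective (r : StrictPref (SPair S)) : Function.Injective (offer r) := by
  intro s t h
  unfold offer at h
  split_ifs at h <;> simpa using h

theorem offer_ne_none (r : StrictPref (SPair S)) (s : S) : offer r s ≠ (none, none) := by
  unfold offer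
  split_ifs <;> simp

/-- The market in which the students' preferences are those over the pairs that they apply for. -/
noncomputable def market (π : S → StrictPref (Option I)) (q : S → ℕ × ℕ) (p : Profile I S) :
    Market I S where
  pref i := (p i).1.comap (offer (p i).1) (offer_injective _)
  acc i := {s | (p i).1.rel (offer (p i).1 s) (none, none)}
  ch s X := keep p (π s) (q s) X
  ch_subset s X := (Ch_subset _ _ _).trans (contenders_subset (fun i => PO (p i).1) (π s) (q s).1 X)
  substitutable s _ _ _ h hX hY :=
    Ch_contenders_substitutable (fun i => PO (p i).1) (π s) (q s).1 (q s).2 h hX hY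
  card_mono s _ _ h := card_Ch_contenders_mono (fun i => PO (p i).1) (π s) (q s).1 (q s).2 h

variable {π : S → StrictPref (Option I)} {q : S → ℕ × ℕ} {p : Profile I S}

/-- Comparing with acceptable schools suffices: the offer of an unacceptable school is below (∅,∅),
and so below every acceptable offer. -/
theorem isTop_iff_top {i : I} {R : Finset S} {s : S} :
    IsTop (p i).1 R s ↔ (market π q p).Top i R s := by
  refine and_congr_right fun _ => and_congr_right fun hs => ?_
  refine ⟨fun h t ht _ => h t ht, fun h t ht hts => ?_⟩
  by_cases hta : (p i).1.rel (offer (p i).1 t) (none, none)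
  · exact h t ht hta hts
  · exact (p i).1.trans _ _ _ hs (((p i).1.total _ _ (offer_ne_none _ t)).resolve_left hta)

theorem target_eq_some_iff {i : I} {R : Finset S} {s : S} :
    target (p i).1 R = some s ↔ (market π q p).Top i R s := by
  unfold target
  by_cases h : ∃ s, IsTop (p i).1 R s
  · rw [dif_pos h]
    have hc := isTop_iff_top (π := π) (q := q).1 h.choose_spec
    exact ⟨fun hs => Option.some_injective _ hs ▸ hc, fun hs => by rw [hc.unique hs]⟩
  · rw [dif_neg h]
    exact ⟨fun hs => by simp at hs, fun hs => absurd ⟨s, isTop_iff_top.2 hs⟩ h⟩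

variable [Fintype I]

theorem applicants_eq (A : Finset I) (R : I → Finset S) (s : S) :
    applicants p A R s = (market π q p).applicants A R s := by
  ext i
  simp [applicants, Market.mem_applicants, target_eq_some_iff (π := π) (q := q)]

variable [Fintype S]

theorem mem_round {A : Finset I} {R : I → Finset S} {i : I} {s : S} :
    s ∈ round p π q A R i ↔ s ∈ R i ∨ (i ∈ (market π q p).applicants A R s ∧
      i ∉ (market π q p).ch s ((market π q p).applicants A R s)) := by
  classical
  unfold round
  rw [Finset.mem_union, Finset.mem_filter, applicants_eq (π := π) (q := q)]
  simp only [Finset.mem_univ, true_and]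
  rfl

theorem justified_round {A : Finset I} {R : I → Finset S}
    (h : (market π q p).Justified A R) : (market π q p).Justified A (round p π q A R) :=
  h.step (fun _ _ hs => mem_round.2 (Or.inl hs)) fun _ _ => mem_round.1

theorem justified_spda {A : Finset I} {R : I → Finset S}
    (h : (market π q p).Justified A R) :
    (market π q p).Justified A (spda p π q A R) ∧
      round p π q A (spda p π q A R) = spda p π q A R := by
  induction R using spda.induct p π q A with
  | case1 R hR =>
    rw [spda, if_pos hR]
    exact ⟨h, hR⟩
  | case2 R hR ih =>
    rw [spda, if_neg hR]
    exact ih (justified_round h)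

open Classical in
theorem justified_foldl (l : List I) {AR : Finset I × (I → Finset S)}
    (h : (market π q p).Justified AR.1 AR.2) (hfix : round p π q AR.1 AR.2 = AR.2) :
    ∃ A : Finset I, AR.1 ⊆ A ∧ (∀ i ∈ l, i ∈ A) ∧
      (market π q p).Justified A (l.foldl (fun AR i =>
        (insert i AR.1, spda p π q (insert i AR.1) AR.2)) AR).2 ∧
      round p π q A (l.foldl (fun AR i =>
        (insert i AR.1, spda p π q (insert i AR.1) AR.2)) AR).2 = (l.foldl (fun AR i =>
        (insert i AR.1, spda p π q (insert i AR.1) AR.2)) AR).2 := by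
  induction l generalizing AR with
  | nil => exact ⟨AR.1, subset_rfl, by simp, h, hfix⟩
  | cons i l ih =>
    have hs := justified_spda (h.mono (Finset.subset_insert i AR.1))
    obtain ⟨A, hA, hl, hJ⟩ :=
      ih (AR := (insert i AR.1, spda p π q (insert i AR.1) AR.2)) hs.1 hs.2
    refine ⟨A, (Finset.subset_insert i AR.1).trans hA, fun j hj => ?_, hJ⟩
    rcases List.mem_cons.1 hj with rfl | hj
    · exact hA (Finset.mem_insert_self _ _)
    · exact hl j hj

/-- The outcome of the adapted algorithm does not depend on the order of entry: it is the
student-optimal stable assignment. -/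
theorem studentOptimal_finalRejections (ρ : EntryOrder I S) :
    (market π q p).StudentOptimal fun i => target (p i).1 (finalRejections π q ρ p i) := by
  classical
  have h := justified_spda ((market π q p).justified_empty
    (Finset.univ.filter fun i => PO (p i).1))
  obtain ⟨A, hA, hl, hJ, hfix⟩ := justified_foldl (ρ.order p)
    (AR := (Finset.univ.filter fun i => PO (p i).1,
      spda p π q (Finset.univ.filter fun i => PO (p i).1) fun _ => ∅)) h.1 h.2
  have hAu : A = Finset.univ := by
    refine Finset.eq_univ_of_forall fun i => ?_
    by_cases hi : PO (p i).1
    · exact hA (by simpa using hi)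
    · exact hl i ((ρ.mem_iff p i).2 hi)
  subst hAu
  change (market π q p).Justified Finset.univ (finalRejections π q ρ p) at hJ
  change round p π q Finset.univ (finalRejections π q ρ p) = finalRejections π q ρ p at hfix
  refine hJ.studentOptimal (fun s i hi => ?_) fun i s => target_eq_some_iff
  by_contra hch
  have : s ∈ round p π q Finset.univ (finalRejections π q ρ p) i := mem_round.2 (Or.inr ⟨hi, hch⟩)
  rw [hfix] at this
  exact (Market.mem_applicants.1 hi).2.1 this

end Mechanism

end Childcare

/-! ### Strategy-proofness -/

open Childcare in
theorem theorem2 {I S : Type*} [Fintype I] [Fintype S]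
    (π : S → Childcare.StrictPref (Option I)) (q : S → ℕ × ℕ) (ρ : Childcare.EntryOrder I S) :
    Childcare.StrategyProofForStudents (Childcare.aSPDA π q ρ) := by
  classical
  rintro ⟨p, i, r', hgain⟩
  set p' := Function.update p i r' with hp'
  have hp'i : p' i = r' := by simp [hp']
  have hp'j : ∀ j, j ≠ i → p' j = p j := fun j hj => by simp [hp', hj]
  have hopt := studentOptimal_finalRejections (π := π) (q := q) (p := p) ρ
  have hopt' := studentOptimal_finalRejections (π := π) (q := q) (p := p') ρ
  set r := (p i).1 with hr
  change r.rel (((target (p' i).1 (finalRejections π q ρ p' i)).map (offer (p' i).1)).getD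
    (none, none)) (((target r (finalRejections π q ρ p i)).map (offer r)).getD
    (none, none)) at hgain
  have hacc : ∀ s, target r (finalRejections π q ρ p i) = some s →
      r.rel (offer r s) (none, none) := fun s hs => hopt.1.acc (j := i) hs
  set out := ((target r (finalRejections π q ρ p i)).map (offer r)).getD (none, none) with hout
  have hIR : ¬ r.rel (none, none) out := by
    cases hm : target r (finalRejections π q ρ p i) with
    | none => simpa [hout, hm] using r.irrefl _
    | some t => simpa [hout, hm] using r.asymm (hacc t hm)
  cases hm' : target (p' i).1 (finalRejections π q ρ p' i) with
  | none => exact hIR (by simpa [hm'] using hgain)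
  | some s =>
    replace hgain : r.rel (offer r'.1 s) out := by
      rw [hm'] at hgain
      simpa [hp'i] using hgain
    -- A willing-to-remain student reporting priority-only would get (∅,s), worse than (∅,∅),
    -- contradicting individual rationality `hIR`.
    by_cases htype : PO r'.1 ∧ ¬ PO r
    · obtain ⟨P, hP | hP⟩ := (p i).2
      · exact htype.2 ⟨P, hP⟩
      · have h := hP.2.2 none (some s) (by simp)
        rw [offer, if_pos htype.1] at hgain
        exact hIR (r.trans _ _ _ h hgain)
    -- The gain is restated with the pair she truthfully applies for at `s`; for a priority-only
    -- student (∅,s) beats (s,s).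
    have hgain' : r.rel (offer r s) out := by
      by_cases hPO : PO r
      · rw [offer, if_pos hPO]
        by_cases hPO' : PO r'.1
        · rwa [offer, if_pos hPO'] at hgain
        · rw [offer, if_neg hPO'] at hgain
          obtain ⟨P, hP⟩ := hPO
          exact r.trans _ _ _ (hP.2 s (some s)) hgain
      · have hPO' : ¬ PO r'.1 := fun h => htype ⟨h, hPO⟩
        rw [offer, if_neg hPO'] at hgain
        rwa [offer, if_neg hPO]
    have hs : r.rel (offer r s) (none, none) := by
      by_cases h0 : out = (none, none)
      · rwa [h0] at hgain'
      · exact r.trans _ _ _ hgain' ((r.total _ _ h0).resolve_right hIR)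
    have hch : ∀ t X, i ∉ (market π q p).ch t X →
        (market π q p').ch t X = (market π q p).ch t X := by
      intro t X hi
      by_cases hsame : PO r ↔ PO r'.1
      · have : (fun j => PO (p' j).1) = fun j => PO (p j).1 := by
          funext j
          by_cases hj : j = i
          · subst hj; rw [hp'i]; exact propext hsame.symm
          · rw [hp'j j hj]
        change Ch (π t) (q t).2 (contenders (fun j => PO (p' j).1) (π t) (q t).1 X) =
          Ch (π t) (q t).2 (contenders (fun j => PO (p j).1) (π t) (q t).1 X)
        rw [this]
      -- The only type change left is from priority-only to willing-to-remain.
      · refine Ch_contenders_eq_of_notMem (T := fun j => PO (p j).1)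
          (T' := fun j => PO (p' j).1) (i := i) (by change PO r; tauto)
          (by rw [hp'i]; tauto) (fun j hj => by rw [hp'j j hj]) hi
    obtain ⟨t, ht, hts⟩ := hopt.weakPref_of_misreport (i := i) (s := s) hopt'.1
      (fun j hj => by simp [market, hp'j j hj]) (fun j hj => by simp [market, hp'j j hj])
      hch hm' hs
    have hot : out = offer r t := by
      have ht : target r (finalRejections π q ρ p i) = some t := ht
      simp [hout, ht]
    rw [hot] at hgain'
    rcases hts with rfl | hts
    · exact r.irrefl _ hgain'
    · exact r.asymm hgain' hts
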